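/- Let $\alpha$ be a linear ordering, $(S,\cdot)$ a finite nonempty semigroup, and $\sigma$ an additive labelling from $\alpha$ to $S$, i.e. a map assigning to each pair $x<y$ of elements of $\alpha$ an element $\sigma(x,y)\in S$ such that $\sigma(x,y)\cdot\sigma(y,z)=\sigma(x,z)$ for all $x<y<z$ in $\alpha$. A split of $\alpha$ of height $N\in\mathbb N$ is a map $s:\alpha\to\{1,\dots,N\}$. Given a split $s$ and $k\in\{1,\dots,N\}$, elements $x,y\in\alpha$ are $k$-neighbours if $s(x)=s(y)=k$ and $s(z)\ge k$ for all $z$ in the closed interval between $x$ and $y$. The split $s$ is ramseyan for $(\alpha,\sigma)$ if for every $k\in\{1,\dots,N\}$ and all $x<y$ and $x'<y'$ in $\alpha$ such that $x,y,x',y'$ are pairwise $k$-neighbours, one has $\sigma(x,y)=\sigma(x',y')=\sigma(x,y)^2$. The ordering $\alpha$ is complete if every nonempty subset of $\alpha$ with an upper bound has a least upper bound in $\alpha$ and every nonempty subset of $\alpha$ with a lower bound has a greatest lower bound in $\alpha$. **Theorem.** 1. If $\alpha$ is complete, then there exists a ramseyan split for $(\alpha,\sigma)$ of height at most $3|S|$.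 2. If $\alpha$ is an ordinal (that is, $\alpha$ is well ordered), then there exists a ramseyan split for $(\alpha,\sigma)$ of height at most $|S|$. -/

import Mathlib

universe u v

/-- A linear ordering is complete if every nonempty subset with an upper bound has a least upper
bound, and every nonempty subset with a lower bound has a greatest lower bound. -/
def IsCompleteOrdering (α : Type u) [LinearOrder α] : Prop :=
  (∀ A : Set α, A.Nonempty → BddAbove A → ∃ a, IsLUB A a) ∧
    (∀ A : Set α, A.Nonempty → BddBelow A → ∃ a, IsGLB A a)

/-- An additive labelling from a linear ordering `α` to a semigroup `S`: a map `σ` defined on the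
pairs `x < y` of elements of `α`, with `σ(x,y) σ(y,z) = σ(x,z)` for all `x < y < z`. -/
structure AdditiveLabelling (α : Type u) [LinearOrder α] (S : Type v) [Semigroup S] where
  label : ∀ x y : α, x < y → S
  label_mul_label : ∀ (x y z : α) (hxy : x < y) (hyz : y < z),
    label x y hxy * label y z hyz = label x z (hxy.trans hyz)

/-- A split of height `N` is a map from `α` to `[1, N]`. -/
def IsSplit {α : Type u} (N : ℕ) (s : α → ℕ) : Prop :=
  ∀ x, s x ∈ Set.Icc 1 N

/-- `x` and `y` are `k`-neighbours for `s`: both have value `k`, and no element of the closed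
interval between them (in whichever order they come) has a value below `k`. -/
def IsNeighbour {α : Type u} [LinearOrder α] (s : α → ℕ) (k : ℕ) (x y : α) : Prop :=
  s x = k ∧ s y = k ∧ ∀ z ∈ Set.uIcc x y, k ≤ s z

/-- A split `s` of height `N` is ramseyan for `σ` if, for every `k` in `[1, N]`, whenever `x < y`
and `x' < y'` are such that `x, y, x', y'` are all `k`-neighbours,
`σ(x,y) = σ(x',y') = σ(x,y)²`. -/
def IsRamseyan {α : Type u} [LinearOrder α] {S : Type v} [Semigroup S]
    (σ : AdditiveLabelling α S) (N : ℕ) (s : α → ℕ) : Prop :=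
  ∀ k ∈ Set.Icc 1 N, ∀ (x y x' y' : α) (hxy : x < y) (hxy' : x' < y'),
    (∀ a ∈ ({x, y, x', y'} : Set α), ∀ b ∈ ({x, y, x', y'} : Set α), IsNeighbour s k a b) →
      σ.label x y hxy = σ.label x' y' hxy' ∧
        σ.label x' y' hxy' = σ.label x y hxy * σ.label x y hxy

/-- There is a ramseyan split for `(α, σ)` of height at most `h`. -/
def HasRamseyanSplitOfHeightAtMost {α : Type u} [LinearOrder α] {S : Type v} [Semigroup S]
    (σ : AdditiveLabelling α S) (h : ℕ) : Prop :=
  ∃ N ≤ h, ∃ s : α → ℕ, IsSplit N s ∧ IsRamseyan σ N s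

-- Work in the finite monoid obtained from `S` by adjoining 1, and induct on a union `T` of
-- J-classes containing all labels on a convex set. Let J be a minimal class in `T`. Enlarging an
-- interval lowers its label in the ideal order, so any interval containing one with label in J
-- again has its label in J. Points are selected so that no label inside a convex component of the
-- remainder lies in J. Coloured selected points take the lowest values of the split, and each
-- component is split by induction on `T` minus J (`exists_isRamseyanOn_of_colouring`).
--
-- The cost is the number of colours. If the mutual labels of a family lie in J and J contains a
-- product of two of its elements, then each point carries an idempotent of J acting as an identity
-- on the labels ending or starting there. Labels between points with the same idempotent e lie in
-- the group at e and come from a potential; the potential is the colour. These groups are disjoint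
-- subsets of J, so |J| colours suffice, and equal colours force the label e
-- (`exists_group_colouring`).
--
-- In a well order one greedy family per class suffices, giving |S|. In a complete order a maximal
-- family must be supplemented by suprema, giving three families (`exists_three_colouring`) and
-- 3|S|; a class containing no product of two of its elements needs only one point
-- (`exists_isolating_point`).

universe w

/-! ### Principal two-sided ideals in finite monoids -/

section Monoid

variable {M : Type w} [Monoid M]

/-- `JLE a b` means that `a` lies in the two-sided ideal generated by `b`. -/
def JLE (a b : M) : Prop := ∃ u v, a = u * b * v

/-- `JEquiv a b` means that `a` and `b` generate the same two-sided ideal. -/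
def JEquiv (a b : M) : Prop := JLE a b ∧ JLE b a

theorem JLE.refl (a : M) : JLE a a := ⟨1, 1, by simp⟩

theorem JLE.trans {a b c : M} (h₁ : JLE a b) (h₂ : JLE b c) : JLE a c := by
  obtain ⟨u, v, rfl⟩ := h₁
  obtain ⟨u', v', rfl⟩ := h₂
  exact ⟨u * u', v' * v, by simp only [mul_assoc]⟩

theorem JLE.mul_left (a b : M) : JLE (a * b) b := ⟨a, 1, by simp⟩

theorem JLE.mul_right (a b : M) : JLE (a * b) a := ⟨1, b, by simp⟩

theorem JEquiv.refl (a : M) : JEquiv a a := ⟨.refl a, .refl a⟩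

theorem JEquiv.symm {a b : M} (h : JEquiv a b) : JEquiv b a := ⟨h.2, h.1⟩

theorem JEquiv.trans {a b c : M} (h₁ : JEquiv a b) (h₂ : JEquiv b c) : JEquiv a c :=
  ⟨h₁.1.trans h₂.1, h₂.2.trans h₁.2⟩

theorem exists_pow_mul_pow_eq_pow [Finite M] (a : M) : ∃ n, 0 < n ∧ a ^ n * a ^ n = a ^ n := by
  obtain ⟨i, j, hij, h⟩ : ∃ i j : ℕ, i < j ∧ a ^ i = a ^ j := by
    obtain ⟨i, j, hne, h⟩ := Finite.exists_ne_map_eq_of_infinite (fun n : ℕ => a ^ n)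
    rcases lt_or_gt_of_ne hne with hlt | hlt
    · exact ⟨i, j, hlt, h⟩
    · exact ⟨j, i, hlt, h.symm⟩
  obtain ⟨k, rfl⟩ := Nat.exists_eq_add_of_lt hij
  have hper : ∀ t r, a ^ (i + r) = a ^ (i + r + t * (k + 1)) := by
    intro t
    induction t with
    | zero => simp
    | succ t ih =>
      intro r
      have e : i + r + (t + 1) * (k + 1) = i + (r + (k + 1)) + t * (k + 1) := by ring
      rw [e, ← ih, pow_add, h, ← pow_add]
      congr 1
      ring
  -- A multiple of the period `k + 1` that is at least `i`; the factor `i + 1` keeps it positive.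
  refine ⟨(i + 1) * (k + 1), by positivity, ?_⟩
  have e : (i + 1) * (k + 1) = i + (i * k + k + 1) := by ring
  rw [← pow_add]
  conv_rhs => rw [e, hper (i + 1), ← e]

variable [Finite M]

/-- Stability of finite monoids: iterating `a = u * a * (b * v)` and passing to an idempotent power
of `u` gives `u ^ n * a = a`, so the left factor drops out. -/
theorem exists_eq_mul_mul_of_JLE_mul {a b : M} (h : JLE a (a * b)) : ∃ v, a = a * b * v := by
  obtain ⟨u, v, huv⟩ := h
  obtain ⟨n, hn, hi⟩ := exists_pow_mul_pow_eq_pow u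
  have hpow : ∀ n, a = u ^ n * a * (b * v) ^ n := by
    intro n
    induction n with
    | zero => simp
    | succ n ih =>
      calc a = u ^ n * a * (b * v) ^ n := ih
        _ = u ^ n * (u * (a * b) * v) * (b * v) ^ n := by rw [← huv]
        _ = _ := by rw [pow_succ u, pow_succ' (b * v)]; simp only [mul_assoc]
  have hua : u ^ n * a = a := by
    calc u ^ n * a = u ^ n * (u ^ n * a * (b * v) ^ n) := by rw [← hpow]
      _ = u ^ n * u ^ n * a * (b * v) ^ n := by simp only [mul_assoc]
      _ = a := by rw [hi, ← hpow]
  obtain ⟨n, rfl⟩ := Nat.exists_eq_succ_of_ne_zero hn.ne'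
  refine ⟨v * (b * v) ^ n, ?_⟩
  calc a = u ^ (n + 1) * a * (b * v) ^ (n + 1) := hpow _
    _ = a * (b * v) ^ (n + 1) := by rw [hua]
    _ = _ := by rw [pow_succ']; simp only [mul_assoc]

theorem exists_eq_mul_mul_of_JLE_mul' {a b : M} (h : JLE b (a * b)) : ∃ u, b = u * (a * b) := by
  obtain ⟨u, v, huv⟩ := h
  have : Finite Mᵐᵒᵖ := Finite.of_equiv M MulOpposite.opEquiv
  obtain ⟨w, hw⟩ := exists_eq_mul_mul_of_JLE_mul (M := Mᵐᵒᵖ) (a := .op b) (b := .op a)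
    ⟨.op v, .op u, by simpa [mul_assoc] using congrArg MulOpposite.op huv⟩
  exact ⟨w.unop, by simpa using congrArg MulOpposite.unop hw⟩

/-- If `a`, `b` and `a * b` generate the same ideal, then some idempotent generating that ideal is
both a right identity of `a` and a left identity of `b`. -/
theorem exists_idempotent_between {a b : M} (ha : JLE a (a * b)) (hb : JLE b (a * b)) :
    ∃ e, e * e = e ∧ a * e = a ∧ e * b = b ∧ JEquiv e a := by
  obtain ⟨v, hv⟩ := exists_eq_mul_mul_of_JLE_mul ha
  obtain ⟨u, hu⟩ := exists_eq_mul_mul_of_JLE_mul' hb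
  -- Read as `b * v`, this element fixes `a` from the right; read as `u * a`, it fixes `b` from the
  -- left. Its powers inherit both.
  have huv : u * a = b * v := by
    calc u * a = u * (a * b * v) := by rw [← hv]
      _ = u * (a * b) * v := by simp only [mul_assoc]
      _ = b * v := by rw [← hu]
  obtain ⟨n, hn, hi⟩ := exists_pow_mul_pow_eq_pow (u * a)
  have h1 : ∀ n, a * (u * a) ^ n = a := by
    intro n
    induction n with
    | zero => simp
    | succ n ih => rw [pow_succ, ← mul_assoc, ih, huv, ← mul_assoc, ← hv]
  have h2 : ∀ n, (u * a) ^ n * b = b := by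
    intro n
    induction n with
    | zero => simp
    | succ n ih => rw [pow_succ, mul_assoc, mul_assoc u, ← hu, ih]
  refine ⟨_, hi, h1 n, h2 n, ?_, ?_⟩
  · obtain ⟨n, rfl⟩ := Nat.exists_eq_succ_of_ne_zero hn.ne'
    rw [pow_succ, ← mul_assoc]
    exact .mul_left _ _
  · conv_lhs => rw [← h1 n]
    exact .mul_left _ _

variable {a₀ : M}

/-- In a regular class, every element can be multiplied on either side inside the class. -/
theorem exists_mul_JEquiv {p q a : M} (hp : JEquiv p a₀) (hq : JEquiv q a₀)
    (hpq : JEquiv (p * q) a₀) (ha : JEquiv a a₀) :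
    (∃ b, JEquiv b a₀ ∧ JEquiv (a * b) a₀) ∧ ∃ b, JEquiv b a₀ ∧ JEquiv (b * a) a₀ := by
  obtain ⟨f, hf, -, -, hfp⟩ :=
    exists_idempotent_between (hp.1.trans hpq.2) (hq.1.trans hpq.2)
  have hfa : JEquiv f a := hfp.trans (hp.trans ha.symm)
  have hf0 : JEquiv f a₀ := hfp.trans hp
  -- The given element factors as `u * f * v` through an idempotent `f`. Stability makes `v` and `u`
  -- cancellable next to `f`, which yields the partners `w * f` and `f * t`.
  obtain ⟨⟨u, v, rfl⟩, haf⟩ := hfa.symm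
  obtain ⟨w, hw⟩ : ∃ w, f = f * v * w := by
    refine exists_eq_mul_mul_of_JLE_mul (haf.trans ?_)
    rw [mul_assoc]
    exact .mul_left _ _
  obtain ⟨t, ht⟩ : ∃ t, f = t * (u * f) :=
    exists_eq_mul_mul_of_JLE_mul' (haf.trans (.mul_right _ _))
  have hr : u * f * v * (w * f) = u * f := by
    calc u * f * v * (w * f) = u * (f * v * w) * f := by simp only [mul_assoc]
      _ = u * f := by rw [← hw, mul_assoc, hf]
  have hl : f * t * (u * f * v) = f * v := by
    calc f * t * (u * f * v) = f * (t * (u * f)) * v := by simp only [mul_assoc]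
      _ = f * v := by rw [← ht, hf]
  have hwf : f = f * v * (w * f) := by rw [← mul_assoc, ← hw, hf]
  have hft : f = f * t * (u * f) := by rw [mul_assoc, ← ht, hf]
  refine ⟨⟨w * f, ⟨(JLE.mul_left _ _).trans hf0.1, hf0.2.trans ?_⟩, ?_⟩,
    ⟨f * t, ⟨(JLE.mul_right _ _).trans hf0.1, hf0.2.trans ?_⟩, ?_⟩⟩
  · conv_lhs => rw [hwf]
    exact .mul_left _ _
  · rw [hr]
    refine ⟨(JLE.mul_left _ _).trans hf0.1, hf0.2.trans ?_⟩
    conv_lhs => rw [ht]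
    exact .mul_left _ _
  · conv_lhs => rw [hft]
    exact .mul_right _ _
  · rw [hl]
    refine ⟨(JLE.mul_right _ _).trans hf0.1, hf0.2.trans ?_⟩
    conv_lhs => rw [hw]
    exact .mul_right _ _

/-- The maximal subgroup at `e`, as a set. -/
def maximalSubgroup (e : M) : Set M := {h | JEquiv h e ∧ e * h = h ∧ h * e = h}

/-- Stability gives `e = h * v`, hence `e = h ^ n * e * v ^ n`. An idempotent power of `h` must then
be `e`, and the preceding power supplies the inverse. -/
theorem exists_inverse {e h : M} (he : e * e = e) (hh : h ∈ maximalSubgroup e) :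
    ∃ u ∈ maximalSubgroup e, u * h = e ∧ h * u = e := by
  obtain ⟨hJ, h1, h2⟩ := hh
  obtain ⟨v, hv⟩ : ∃ v, e = e * h * v := exists_eq_mul_mul_of_JLE_mul (by rw [h1]; exact hJ.2)
  rw [h1] at hv
  have hpow : ∀ n, e = h ^ n * e * v ^ n := by
    intro n
    induction n with
    | zero => simp
    | succ n ih =>
      calc e = h ^ n * e * v ^ n := ih
        _ = h ^ n * (h * e * v) * v ^ n := by rw [h2, ← hv]
        _ = _ := by rw [pow_succ h, pow_succ' v]; simp only [mul_assoc]
  obtain ⟨n, hn, hi⟩ := exists_pow_mul_pow_eq_pow h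
  obtain ⟨n, rfl⟩ := Nat.exists_eq_succ_of_ne_zero hn.ne'
  have hne : h ^ (n + 1) * e = h ^ (n + 1) := by rw [pow_succ, mul_assoc, h2]
  have hpe : h ^ (n + 1) = e := by
    calc h ^ (n + 1) = h ^ (n + 1) * (h ^ (n + 1) * e * v ^ (n + 1)) := by rw [← hpow, hne]
      _ = h ^ (n + 1) * h ^ (n + 1) * e * v ^ (n + 1) := by simp only [mul_assoc]
      _ = e := by rw [hi, ← hpow]
  have hu1 : e * h ^ n * e * h = e := by
    rw [mul_assoc _ e, h1, mul_assoc, ← pow_succ, hpe, he]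
  -- Here `n` may be 0; the outer factors `e` keep the element in the group.
  refine ⟨e * h ^ n * e, ⟨⟨.mul_left _ _, ?_⟩, ?_, ?_⟩, hu1, ?_⟩
  · conv_lhs => rw [← hu1]
    exact .mul_right _ _
  · simp only [← mul_assoc, he]
  · simp only [mul_assoc, he]
  · rw [← mul_assoc, ← mul_assoc, h2, ← pow_succ', hpe, he]

/-- Both `e` and `f` equal `e * f`, by inverting `h` in either group. Thus a group element, used as
a colour, remembers its idempotent. -/
theorem eq_of_mem_maximalSubgroup {e f h : M} (he : e * e = e) (hf : f * f = f)
    (hhe : h ∈ maximalSubgroup e) (hhf : h ∈ maximalSubgroup f) : e = f := by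
  obtain ⟨u, -, hu, -⟩ := exists_inverse he hhe
  obtain ⟨u', -, -, hu'⟩ := exists_inverse hf hhf
  have h1 : e * f = e := by rw [← hu, mul_assoc, hhf.2.2]
  have h2 : e * f = f := by rw [← hu', ← mul_assoc, hhe.2.1]
  rw [← h1, h2]

end Monoid

/-! ### Labellings with values in a monoid -/

section Labelling

variable {α : Type u} [LinearOrder α] {M : Type w} [Monoid M]

/-- Additive labellings with values in a monoid, extended by `1` on the diagonal. -/
structure IsAdditive (ℓ : α → α → M) : Prop where
  self : ∀ x, ℓ x x = 1
  mul : ∀ {x y z}, x ≤ y → y ≤ z → ℓ x y * ℓ y z = ℓ x z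

theorem IsAdditive.JLE {ℓ : α → α → M} (hℓ : IsAdditive ℓ) {x' x y y' : α} (h₁ : x' ≤ x)
    (h₂ : x ≤ y) (h₃ : y ≤ y') : JLE (ℓ x' y') (ℓ x y) :=
  ⟨ℓ x' x, ℓ y y', by rw [hℓ.mul h₁ h₂, hℓ.mul (h₁.trans h₂) h₃]⟩

/-- Points with a common local idempotent `e` are coloured by a potential in the group at `e`. -/
theorem exists_potential [Finite M] {ℓ : α → α → M} (hℓ : IsAdditive ℓ) {e : M} (he : e * e = e)
    (Y : Set α) (hY : ∀ x ∈ Y, ∀ y ∈ Y, x < y → ℓ x y ∈ maximalSubgroup e) :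
    ∃ g : α → M, (∀ x ∈ Y, g x ∈ maximalSubgroup e) ∧
      ∀ x ∈ Y, ∀ y ∈ Y, x < y → g x * ℓ x y = g y := by
  have hee : e ∈ maximalSubgroup e := ⟨.refl e, he, he⟩
  rcases Y.eq_empty_or_nonempty with rfl | ⟨x₀, hx₀⟩
  · exact ⟨fun _ => e, by simp, by simp⟩
  -- The potential is the label from `x₀`, or the inverse of the label to `x₀`. The factor `e`
  -- replaces the diagonal value 1 by `e`.
  have key : ∀ x, ∃ u, x ∈ Y → u ∈ maximalSubgroup e ∧ (x₀ ≤ x → u = e * ℓ x₀ x) ∧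
      (x < x₀ → u * ℓ x x₀ = e ∧ ℓ x x₀ * u = e) := by
    intro x
    by_cases hx : x ∈ Y
    · rcases lt_trichotomy x x₀ with h | rfl | h
      · obtain ⟨u, hu, h1, h2⟩ := exists_inverse he (hY x hx x₀ hx₀ h)
        exact ⟨u, fun _ => ⟨hu, fun h' => absurd h h'.not_gt, fun _ => ⟨h1, h2⟩⟩⟩
      · exact ⟨e, fun _ => ⟨hee, fun _ => by rw [hℓ.self, mul_one], fun h => absurd h (lt_irrefl _)⟩⟩
      · have := hY x₀ hx₀ x hx h
        exact ⟨e * ℓ x₀ x, fun _ => ⟨by rwa [this.2.1], fun _ => rfl, fun h' => absurd h h'.not_gt⟩⟩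
    · exact ⟨1, fun h => absurd h hx⟩
  choose g hg using key
  refine ⟨g, fun x hx => (hg x hx).1, fun x hx y hy hxy => ?_⟩
  obtain ⟨gx, gx1, gx2⟩ := hg x hx
  obtain ⟨gy, gy1, gy2⟩ := hg y hy
  rcases le_or_gt x₀ x with h | h
  · rw [gx1 h, gy1 (h.trans hxy.le), mul_assoc, hℓ.mul h hxy.le]
  · obtain ⟨h1, -⟩ := gx2 h
    rcases le_or_gt x₀ y with h' | h'
    · rw [gy1 h', ← hℓ.mul h.le h', ← mul_assoc, h1]
    · obtain ⟨h3, h4⟩ := gy2 h'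
      have hxye := (hY x hx y hy hxy).2.2
      calc g x * ℓ x y = g x * (ℓ x y * (ℓ y x₀ * g y)) := by rw [h4, hxye]
        _ = g x * (ℓ x y * ℓ y x₀) * g y := by simp only [mul_assoc]
        _ = g y := by rw [hℓ.mul hxy.le h'.le, h1, gy.2.1]

/-- A set of points whose mutual labels lie in one regular class can be coloured by the elements of
that class so that points of the same colour are separated by an idempotent depending on the colour
only. -/
theorem exists_group_colouring [Finite M] {ℓ : α → α → M} (hℓ : IsAdditive ℓ) {a₀ : M} (Y : Set α)
    (hY : ∀ x ∈ Y, ∀ y ∈ Y, x < y → JEquiv (ℓ x y) a₀)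
    (hreg : ∀ x ∈ Y, ∀ y ∈ Y, x < y →
      ∃ p q, JEquiv p a₀ ∧ JEquiv q a₀ ∧ JEquiv (p * q) a₀) :
    ∃ (g : α → {a // JEquiv a a₀}) (ε : {a // JEquiv a a₀} → M),
      ∀ x ∈ Y, ∀ y ∈ Y, x < y → g x = g y →
        ℓ x y = ε (g x) ∧ ε (g x) * ε (g x) = ε (g x) := by
  -- Regularity of the class is available only once a pair exists; otherwise any colouring works.
  by_cases hpair : ∃ x ∈ Y, ∃ y ∈ Y, x < y
  swap
  · exact ⟨fun _ => ⟨a₀, .refl a₀⟩, fun _ => 1, fun x hx y hy hxy => absurd ⟨x, hx, y, hy, hxy⟩ hpair⟩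
  obtain ⟨x₁, hx₁, y₁, hy₁, hxy₁⟩ := hpair
  obtain ⟨p, q, hp, hq, hpq⟩ := hreg x₁ hx₁ y₁ hy₁ hxy₁
  have hidem : ∀ x, ∃ e, x ∈ Y → e * e = e ∧ JEquiv e a₀ ∧ (∀ w ∈ Y, w < x → ℓ w x * e = ℓ w x) ∧
      ∀ z ∈ Y, x < z → e * ℓ x z = ℓ x z := by
    intro x
    by_cases hx : x ∈ Y
    swap
    · exact ⟨1, fun h => absurd h hx⟩
    have hA : ∀ w₀ ∈ Y, w₀ < x → ∀ w ∈ Y, w < x → ∃ t, ℓ w x = t * ℓ w₀ x := by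
      intro w₀ hw₀ h₀ w hw h
      rcases le_total w w₀ with h' | h'
      · exact ⟨ℓ w w₀, (hℓ.mul h' h₀.le).symm⟩
      · have e := hℓ.mul h' h.le
        obtain ⟨u, hu⟩ := exists_eq_mul_mul_of_JLE_mul' (a := ℓ w₀ w) (b := ℓ w x)
          (by rw [e]; exact (hY w hw x hx h).1.trans (hY w₀ hw₀ x hx h₀).2)
        exact ⟨u, by rw [← e]; exact hu⟩
    have hB : ∀ z₀ ∈ Y, x < z₀ → ∀ z ∈ Y, x < z → ∃ t, ℓ x z = ℓ x z₀ * t := by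
      intro z₀ hz₀ h₀ z hz h
      rcases le_total z₀ z with h' | h'
      · exact ⟨ℓ z₀ z, (hℓ.mul h₀.le h').symm⟩
      · have e := hℓ.mul h.le h'
        obtain ⟨u, hu⟩ := exists_eq_mul_mul_of_JLE_mul (a := ℓ x z) (b := ℓ z z₀)
          (by rw [e]; exact (hY x hx z hz h).1.trans (hY x hx z₀ hz₀ h₀).2)
        exact ⟨u, by rw [← e]; exact hu⟩
    -- By stability, every label ending at `x` is a left multiple of any other, and dually on the
    -- right, so one factor on each side suffices. A side of `x` without points of `Y` gets its
    -- factor from regularity.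
    obtain ⟨a, b, ha, hb, hab, haA, hbB⟩ : ∃ a b, JEquiv a a₀ ∧ JEquiv b a₀ ∧ JEquiv (a * b) a₀ ∧
        (∀ w ∈ Y, w < x → ∃ t, ℓ w x = t * a) ∧ ∀ z ∈ Y, x < z → ∃ t, ℓ x z = b * t := by
      by_cases hl : ∃ w₀ ∈ Y, w₀ < x <;> by_cases hr : ∃ z₀ ∈ Y, x < z₀
      · obtain ⟨w₀, hw₀, h₀⟩ := hl
        obtain ⟨z₀, hz₀, h₁⟩ := hr
        exact ⟨_, _, hY w₀ hw₀ x hx h₀, hY x hx z₀ hz₀ h₁,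
          by rw [hℓ.mul h₀.le h₁.le]; exact hY _ hw₀ _ hz₀ (h₀.trans h₁), hA w₀ hw₀ h₀, hB z₀ hz₀ h₁⟩
      · obtain ⟨w₀, hw₀, h₀⟩ := hl
        obtain ⟨b, hb, hab⟩ := (exists_mul_JEquiv hp hq hpq (hY w₀ hw₀ x hx h₀)).1
        exact ⟨_, b, hY w₀ hw₀ x hx h₀, hb, hab, hA w₀ hw₀ h₀, fun z hz h => absurd ⟨z, hz, h⟩ hr⟩
      · obtain ⟨z₀, hz₀, h₁⟩ := hr
        obtain ⟨a, ha, hab⟩ := (exists_mul_JEquiv hp hq hpq (hY x hx z₀ hz₀ h₁)).2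
        exact ⟨a, _, ha, hY x hx z₀ hz₀ h₁, hab, fun w hw h => absurd ⟨w, hw, h⟩ hl, hB z₀ hz₀ h₁⟩
      · exact ⟨p, q, hp, hq, hpq, fun w hw h => absurd ⟨w, hw, h⟩ hl,
          fun z hz h => absurd ⟨z, hz, h⟩ hr⟩
    obtain ⟨e, he, hae, heb, hea⟩ :=
      exists_idempotent_between (ha.1.trans hab.2) (hb.1.trans hab.2)
    refine ⟨e, fun _ => ⟨he, hea.trans ha, fun w hw h => ?_, fun z hz h => ?_⟩⟩
    · obtain ⟨t, ht⟩ := haA w hw h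
      rw [ht, mul_assoc, hae]
    · obtain ⟨t, ht⟩ := hbB z hz h
      rw [ht, ← mul_assoc, heb]
  choose e he using hidem
  have hpot : ∀ f, ∃ g : α → M, f * f = f → JEquiv f a₀ →
      (∀ x ∈ Y, e x = f → g x ∈ maximalSubgroup f) ∧
        ∀ x ∈ Y, ∀ y ∈ Y, e x = f → e y = f → x < y → g x * ℓ x y = g y := by
    intro f
    by_cases hf : f * f = f ∧ JEquiv f a₀
    swap
    · exact ⟨fun _ => 1, fun h h' => absurd ⟨h, h'⟩ hf⟩
    obtain ⟨g, h1, h2⟩ := exists_potential hℓ hf.1 {x ∈ Y | e x = f} (by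
      rintro x ⟨hx, rfl⟩ y ⟨hy, hxy⟩ hlt
      exact ⟨(hY x hx y hy hlt).trans hf.2.symm, (he x hx).2.2.2 y hy hlt,
        hxy ▸ (he y hy).2.2.1 x hx hlt⟩)
    exact ⟨g, fun _ _ => ⟨fun x hx hxf => h1 x ⟨hx, hxf⟩,
      fun x hx y hy hxf hyf => h2 x ⟨hx, hxf⟩ y ⟨hy, hyf⟩⟩⟩
  choose γ hγ using hpot
  have hmem : ∀ x ∈ Y, γ (e x) x ∈ maximalSubgroup (e x) := fun x hx =>
    (hγ (e x) (he x hx).1 (he x hx).2.1).1 x hx rfl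
  have hval : ∀ x, ∃ c : {a // JEquiv a a₀}, x ∈ Y → c.1 = γ (e x) x := by
    intro x
    by_cases hx : x ∈ Y
    · exact ⟨⟨γ (e x) x, (hmem x hx).1.trans (he x hx).2.1⟩, fun _ => rfl⟩
    · exact ⟨⟨a₀, .refl a₀⟩, fun h => absurd h hx⟩
  choose g hg using hval
  have hε : ∀ c : {a // JEquiv a a₀}, ∃ f, ∀ x ∈ Y, g x = c → e x = f := by
    intro c
    by_cases hc : ∃ x ∈ Y, g x = c
    · obtain ⟨x, hx, rfl⟩ := hc
      refine ⟨e x, fun y hy hxy => eq_of_mem_maximalSubgroup (he y hy).1 (he x hx).1 (hmem y hy) ?_⟩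
      rw [← hg y hy, hxy, hg x hx]
      exact hmem x hx
    · exact ⟨1, fun x hx hxc => absurd ⟨x, hx, hxc⟩ hc⟩
  choose ε hε using hε
  refine ⟨g, ε, fun x hx y hy hxy hgxy => ?_⟩
  have hex : e x = ε (g x) := hε _ x hx rfl
  have hey : e y = ε (g x) := hε _ y hy hgxy.symm
  rw [← hex]
  refine ⟨?_, (he x hx).1⟩
  have hmul := (hγ (e x) (he x hx).1 (he x hx).2.1).2 x hx y hy rfl (hey.trans hex.symm) hxy
  have hcol : γ (e x) y = γ (e x) x := by
    have := hg y hy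
    rw [hey, ← hex, ← hgxy, hg x hx] at this
    exact this.symm
  rw [hcol] at hmul
  obtain ⟨u, -, hu, -⟩ := exists_inverse (he x hx).1 (hmem x hx)
  calc ℓ x y = e x * ℓ x y := ((he x hx).2.2.2 y hy hxy).symm
    _ = u * (γ (e x) x * ℓ x y) := by rw [← mul_assoc, hu]
    _ = e x := by rw [hmul, hu]

/-! ### Splits on convex subsets -/

/-- `s` restricts to a ramseyan split of height `N` of the set `C`. -/
def IsRamseyanOn (ℓ : α → α → M) (C : Set α) (N : ℕ) (s : α → ℕ) : Prop :=
  (∀ x ∈ C, s x ∈ Set.Icc 1 N) ∧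
    ∀ k, ∀ x ∈ C, ∀ y ∈ C, ∀ x' ∈ C, ∀ y' ∈ C, x < y → x' < y' →
      (∀ a ∈ ({x, y, x', y'} : Set α), ∀ b ∈ ({x, y, x', y'} : Set α), IsNeighbour s k a b) →
        ℓ x y = ℓ x' y' ∧ ℓ x' y' = ℓ x y * ℓ x y

theorem IsRamseyanOn.mono {ℓ : α → α → M} {C : Set α} {N N' : ℕ} {s : α → ℕ}
    (h : IsRamseyanOn ℓ C N s) (hN : N ≤ N') : IsRamseyanOn ℓ C N' s :=
  ⟨fun x hx => ⟨(h.1 x hx).1, (h.1 x hx).2.trans hN⟩, h.2⟩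

/-- A partial colouring whose colours are ramseyan, together with splits of the components of the
uncoloured part, yields a split. -/
theorem exists_isRamseyanOn_of_colouring {ℓ : α → α → M} {C : Set α} (hC : C.OrdConnected)
    {κ : Type v} [Fintype κ] (c : α → Option κ) (N : ℕ)
    (hcol : ∀ x ∈ C, ∀ y ∈ C, ∀ x' ∈ C, ∀ y' ∈ C, x < y → x' < y' → ∀ i, c x = some i →
      c y = some i → c x' = some i → c y' = some i →
        ℓ x y = ℓ x' y' ∧ ℓ x' y' = ℓ x y * ℓ x y)
    (hcomp : ∀ x ∈ C, c x = none →
      ∃ s, IsRamseyanOn ℓ (Set.ordConnectedComponent {z ∈ C | c z = none} x) N s) :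
    ∃ s, IsRamseyanOn ℓ C (Fintype.card κ + N) s := by
  classical
  set U := {z ∈ C | c z = none} with hU
  -- Indexing by the component as a set makes all its points use the same split.
  have hF : ∀ D : Set α, ∃ s, (∃ x ∈ U, Set.ordConnectedComponent U x = D) →
      IsRamseyanOn ℓ D N s := by
    intro D
    by_cases hD : ∃ x ∈ U, Set.ordConnectedComponent U x = D
    · obtain ⟨x, hx, rfl⟩ := hD
      obtain ⟨s, hs⟩ := hcomp x hx.1 hx.2
      exact ⟨s, fun _ => hs⟩
    · exact ⟨fun _ => 0, fun h => absurd h hD⟩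
  choose F hF using hF
  let ι := Fintype.equivFin κ
  -- Colours lie below all component values, so neighbours at a value above the number of colours
  -- have no coloured point between them and share a component.
  let s : α → ℕ := fun x => (c x).elim (Fintype.card κ + F (Set.ordConnectedComponent U x) x)
    (fun i => (ι i : ℕ) + 1)
  have hs_some : ∀ {x i}, c x = some i → s x = ι i + 1 := by
    intro x i h
    simp only [s, h, Option.elim_some]
  have hs_none : ∀ {x}, c x = none →
      s x = Fintype.card κ + F (Set.ordConnectedComponent U x) x := by
    intro x h
    simp only [s, h, Option.elim_none]
  have hself : ∀ {x}, x ∈ U → x ∈ Set.ordConnectedComponent U x := fun h =>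
    Set.self_mem_ordConnectedComponent.2 h
  have hpos : ∀ {x}, x ∈ U →
      F (Set.ordConnectedComponent U x) x ∈ Set.Icc 1 N := fun {x} hx =>
    (hF _ ⟨x, hx, rfl⟩).1 x (hself hx)
  refine ⟨s, fun x hx => ?_, ?_⟩
  · rcases hcx : c x with _ | i
    · have := hpos (x := x) ⟨hx, hcx⟩
      rw [hs_none hcx]
      simp only [Set.mem_Icc] at this ⊢
      omega
    · have := (ι i).2
      rw [hs_some hcx]
      simp only [Set.mem_Icc]
      omega
  intro k x hx y hy x' hx' y' hy' hxy hxy' hn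
  have hk : ∀ a ∈ ({x, y, x', y'} : Set α), s a = k := fun a ha => (hn a ha a ha).1
  have hsub : ({x, y, x', y'} : Set α) ⊆ C := by
    rintro a (rfl | rfl | rfl | rfl) <;> assumption
  rcases hcx : c x with _ | i
  swap
  · have hall : ∀ a ∈ ({x, y, x', y'} : Set α), c a = some i := by
      intro a ha
      have h1 := hk a ha
      rw [← hk x (by simp), hs_some hcx] at h1
      rcases hca : c a with _ | j
      · have := hpos (x := a) ⟨hsub ha, hca⟩
        rw [hs_none hca] at h1
        have := (ι i).2
        simp only [Set.mem_Icc] at *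
        omega
      · rw [hs_some hca] at h1
        have : ι j = ι i := Fin.ext (by omega)
        rw [ι.injective this]
    exact hcol x hx y hy x' hx' y' hy' hxy hxy' i hcx (hall y (by simp)) (hall x' (by simp))
      (hall y' (by simp))
  have hxU : x ∈ U := ⟨hx, hcx⟩
  have hkx : Fintype.card κ + 1 ≤ k := by
    have := hpos hxU
    rw [← hk x (by simp), hs_none hcx]
    simp only [Set.mem_Icc] at this
    omega
  have hnone : ∀ z, k ≤ s z → c z = none := by
    intro z hz
    rcases hcz : c z with _ | j
    · rfl
    · have := (ι j).2
      rw [hs_some hcz] at hz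
      omega
  have hmem : ∀ a ∈ ({x, y, x', y'} : Set α), a ∈ Set.ordConnectedComponent U x := by
    intro a ha z hz
    exact ⟨hC.uIcc_subset hx (hsub ha) hz, hnone z ((hn x (by simp) a ha).2.2 z hz)⟩
  set D := Set.ordConnectedComponent U x with hD
  have hsD : ∀ a ∈ D, s a = Fintype.card κ + F D a := by
    intro a ha
    have haU : a ∈ U := Set.ordConnectedComponent_subset ha
    rw [hs_none haU.2, ← Set.ordConnectedComponent_eq ha]
  have hDc : D.OrdConnected := inferInstance
  refine (hF D ⟨x, hxU, rfl⟩).2 (k - Fintype.card κ) x (hmem _ (by simp)) y (hmem _ (by simp))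
    x' (hmem _ (by simp)) y' (hmem _ (by simp)) hxy hxy' ?_
  intro a ha b hb
  have h1 := hsD a (hmem a ha)
  have h2 := hsD b (hmem b hb)
  have h3 := hk a ha
  have h4 := hk b hb
  refine ⟨by omega, by omega, fun z hz => ?_⟩
  have h5 := hsD z (hDc.uIcc_subset (hmem a ha) (hmem b hb) hz)
  have h6 := (hn a ha b hb).2.2 z hz
  omega

end Labelling

/-! ### Colourings of linear orders -/

/-- Group points at finite distance, fix a representative of each class, and colour by the parity of
the number of points in the interval to it. A covering step stays in the class and changes this
number by one. -/
theorem exists_bool_colouring_covBy (β : Type u) [LinearOrder β] :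
    ∃ c : β → Bool, ∀ x y, x ⋖ y → c x ≠ c y := by
  classical
  let r : Setoid β :=
    { r := fun x y => (Set.uIcc x y).Finite
      iseqv := ⟨fun x => by simp, fun {x y} h => by rwa [Set.uIcc_comm],
        fun {x y z} h h' => (h.union h').subset Set.uIcc_subset_uIcc_union_uIcc⟩ }
  let b : β → β := fun x => (Quotient.mk r x).out
  have hb : ∀ x, (Set.uIcc (b x) x).Finite := fun x => Quotient.mk_out (s := r) x
  refine ⟨fun x => decide (Even (Set.uIcc (b x) x).ncard), fun x y hxy h => ?_⟩
  have hbxy : b x = b y := by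
    have : (Quotient.mk r x) = Quotient.mk r y := by
      refine Quotient.sound (?_ : (Set.uIcc x y).Finite)
      rw [Set.uIcc_of_le hxy.le, hxy.Icc_eq]
      simp
    simp only [b, this]
  have hfx := hb x
  have hfy := hb y
  simp only [decide_eq_decide] at h
  rw [← hbxy] at hfy h
  rcases le_or_gt (b x) x with hle | hlt
  · have e : Set.uIcc (b x) y = insert y (Set.uIcc (b x) x) := by
      ext z
      rw [Set.uIcc_of_le hle, Set.uIcc_of_le (hle.trans hxy.le)]
      simp only [Set.mem_Icc, Set.mem_insert_iff]
      have h1 : z < y ↔ z ≤ x := ⟨fun h => hxy.le_of_lt h, fun h => h.trans_lt hxy.lt⟩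
      have h2 := hle.trans hxy.le
      grind
    rw [e, Set.ncard_insert_of_notMem _ hfx, Nat.even_add_one] at h
    · tauto
    · rw [Set.uIcc_of_le hle]
      exact fun h' => hxy.lt.not_ge h'.2
  · have hle : y ≤ b x := hxy.ge_of_gt hlt
    have e : Set.uIcc (b x) x = insert x (Set.uIcc (b x) y) := by
      ext z
      rw [Set.uIcc_of_ge hle, Set.uIcc_of_ge hlt.le]
      simp only [Set.mem_Icc, Set.mem_insert_iff]
      have h1 : x < z ↔ y ≤ z := ⟨fun h => hxy.ge_of_gt h, fun h => hxy.lt.trans_le h⟩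
      grind
    rw [e, Set.ncard_insert_of_notMem _ hfy, Nat.even_add_one] at h
    · tauto
    · rw [Set.uIcc_of_ge hle]
      exact fun h' => hxy.lt.not_ge h'.1

section Order

variable {α : Type u} [LinearOrder α]

/-- In a well order, points can be selected greedily subject to a binary constraint. -/
theorem exists_greedy_set [WellFoundedLT α] (D : Set α) (Q : α → α → Prop) :
    ∃ X : Set α, ∀ x, x ∈ X ↔ x ∈ D ∧ ∀ w ∈ X, w < x → Q w x := by
  let P : α → Prop := wellFounded_lt.fix
    (fun x ih => x ∈ D ∧ ∀ w (h : w < x), ih w h → Q w x)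
  refine ⟨{x | P x}, fun x => ?_⟩
  have : P x = (x ∈ D ∧ ∀ w, w < x → P w → Q w x) := wellFounded_lt.fix_eq _ _
  simp only [Set.mem_ofPred_eq]
  rw [this]
  exact and_congr_right fun _ => ⟨fun h w hw hwx => h w hwx hw, fun h w hwx hw => h w hw hwx⟩

/-- In a complete order, a monotone relation can be isolated by three sets of points that are
pairwise related. -/
theorem exists_three_colouring
    (hα : ∀ A : Set α, A.Nonempty → BddAbove A → ∃ a, IsLUB A a) {C : Set α}
    (Q : α → α → Prop) (hQ : ∀ w ∈ C, ∀ x ∈ C, ∀ y ∈ C, ∀ z ∈ C, w ≤ x → x < y → y ≤ z →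
      Q x y → Q w z) :
    ∃ c : α → Option (Fin 3),
      (∀ x ∈ C, ∀ y ∈ C, x < y → ∀ i, c x = some i → c y = some i → Q x y) ∧
      (∀ x ∈ C, ∀ y ∈ C, x < y → (∀ z ∈ Set.Icc x y, c z = none) → ¬ Q x y) ∧
      ∀ x ∈ C, c x = none → ∃ y ∈ C, (x < y ∧ ¬ Q x y) ∨ (y < x ∧ ¬ Q y x) := by
  classical
  obtain ⟨X, hX⟩ := zorn_subset {X : Set α | X ⊆ C ∧ ∀ x ∈ X, ∀ y ∈ X, x < y → Q x y} (by
    intro c hc hchain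
    refine ⟨⋃₀ c, ⟨Set.sUnion_subset fun s hs => (hc hs).1, ?_⟩, fun s hs =>
      Set.subset_sUnion_of_mem hs⟩
    rintro x ⟨s, hs, hxs⟩ y ⟨t, ht, hyt⟩ hxy
    rcases hchain.total hs ht with h | h
    · exact (hc ht).2 x (h hxs) y hyt hxy
    · exact (hc hs).2 x hxs y (h hyt) hxy)
  obtain ⟨hXC, hXQ⟩ := hX.prop
  have hmax : ∀ x ∈ C, x ∉ X → ∃ y ∈ X, (x < y ∧ ¬ Q x y) ∨ (y < x ∧ ¬ Q y x) := by
    intro x hx hxX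
    by_contra! hcon
    refine hxX (hX.le_of_ge (y := insert x X) ⟨Set.insert_subset hx hXC, ?_⟩
      (Set.subset_insert x X) (Set.mem_insert x X))
    rintro y (rfl | hy) z (rfl | hz) hyz
    · exact absurd hyz (lt_irrefl _)
    · exact (hcon z hz).1 hyz
    · exact (hcon y hy).2 hyz
    · exact hXQ y hy z hz hyz
  obtain ⟨c₂, hc₂⟩ := exists_bool_colouring_covBy X
  -- Maximality of `X` alone does not suffice: a related pair could sit between consecutive points
  -- of `X`. The supremum of the points at or above `x` not related to `x` cuts such pairs.
  let A : X → Set α := fun x => {u ∈ C | x ≤ u ∧ (x < u → ¬ Q x u)}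
  let c : α → Option (Fin 3) := fun m =>
    if m ∈ X then some 0 else
      if h : ∃ x : X, IsLUB (A x) m then if c₂ h.choose then some 1 else some 2 else none
  have hxA : ∀ x : X, x.1 ∈ A x := fun x => ⟨hXC x.2, le_rfl, fun h => absurd h (lt_irrefl _)⟩
  have hle : ∀ {x x' : X} {m}, IsLUB (A x) m → x < x' → m ≤ x' := by
    intro x x' m hm hxx'
    refine hm.2 fun u hu => ?_
    by_contra! hlt
    exact hu.2.2 ((show x.1 < x'.1 from hxx').trans hlt)
      (hQ x (hXC x.2) x (hXC x.2) x' (hXC x'.2) u hu.1 le_rfl hxx' hlt.le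
        (hXQ x x.2 x' x'.2 hxx'))
  have hX0 : ∀ {m i}, c m = some i → (m ∈ X ↔ i = 0) := by
    intro m i h
    simp only [c] at h
    split_ifs at h with h1 h2 h3 <;> simp only [Option.some.injEq] at h <;> subst h <;> simp [h1]
  have hM : ∀ {m i}, c m = some i → i ≠ 0 →
      ∃ x : X, IsLUB (A x) m ∧ i = if c₂ x then 1 else 2 := by
    intro m i h hi
    simp only [c] at h
    split_ifs at h with h1 h2 h3
    · simp only [Option.some.injEq] at h
      exact absurd h.symm hi
    · simp only [Option.some.injEq] at h
      exact ⟨h2.choose, h2.choose_spec, by rw [h3, ← h]; rfl⟩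
    · simp only [Option.some.injEq] at h
      exact ⟨h2.choose, h2.choose_spec, by rw [← h]; simp [h3]⟩
  have hnone : ∀ {m}, c m = none → m ∉ X ∧ ¬ ∃ x : X, IsLUB (A x) m := by
    intro m h
    simp only [c] at h
    split_ifs at h with h1 h2
    exact ⟨h1, h2⟩
  refine ⟨c, ?_, ?_, ?_⟩
  · intro m hm m' hm' hlt i hi hi'
    by_cases h0 : i = 0
    · exact hXQ m ((hX0 hi).2 h0) m' ((hX0 hi').2 h0) hlt
    have hmX : m ∉ X := fun h => h0 ((hX0 hi).1 h)
    obtain ⟨x, hx, hix⟩ := hM hi h0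
    obtain ⟨x', hx', hix'⟩ := hM hi' h0
    have hcc : c₂ x = c₂ x' := by
      rw [hix] at hix'
      cases h1 : c₂ x <;> cases h2 : c₂ x' <;> simp [h1, h2] at hix' ⊢
    have hxx' : x < x' := by
      rcases lt_trichotomy x x' with h | h | h
      · exact h
      · subst h
        exact absurd (hx.unique hx') hlt.ne
      · exact absurd ((hle hx' h).trans (hx.1 (hxA x))) hlt.not_ge
    -- Equal parity rules out a covering pair. The intermediate `x''` gives `m ≤ x'' < x' ≤ m'`, and
    -- monotonicity applies.
    obtain ⟨x'', h1, h2⟩ : ∃ x'', x < x'' ∧ x'' < x' := by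
      by_contra! hcon
      exact hc₂ x x' ⟨hxx', fun z hz hz' => (hcon z hz).not_gt hz'⟩ hcc
    exact hQ m hm x'' (hXC x''.2) x' (hXC x'.2) m' hm' (hle hx h1) h2 (hx'.1 (hxA x'))
      (hXQ _ x''.2 _ x'.2 h2)
  · intro u hu v hv huv hnone' hquv
    have huX := (hnone (hnone' u ⟨le_rfl, huv.le⟩)).1
    obtain ⟨x, hx, ⟨h1, h2⟩ | ⟨h1, h2⟩⟩ := hmax u hu huX
    · have hvx : v < x := by
        by_contra! h
        exact (hnone (hnone' x ⟨h1.le, h⟩)).1 hx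
      exact h2 (hQ u hu u hu v hv x (hXC hx) le_rfl huv hvx.le hquv)
    · have hb : ∀ w ∈ A ⟨x, hx⟩, w ≤ v := by
        intro w hw
        by_contra! h
        exact hw.2.2 (h1.trans (huv.trans h))
          (hQ x (hXC hx) u hu v hv w hw.1 h1.le huv h.le hquv)
      obtain ⟨m, hm⟩ := hα (A ⟨x, hx⟩) ⟨x, hxA ⟨x, hx⟩⟩ ⟨v, hb⟩
      have hum : u ≤ m := hm.1 ⟨hu, h1.le, fun _ => h2⟩
      exact (hnone (hnone' m ⟨hum, hm.2 hb⟩)).2 ⟨_, hm⟩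
  · intro x hx hxc
    obtain ⟨y, hy, h⟩ := hmax x hx (hnone hxc).1
    exact ⟨y, hXC hy, h⟩

/-- In a complete order, a monotone relation without chains of length two is isolated by at most one
point. -/
theorem exists_isolating_point [Nonempty α]
    (hα : ∀ A : Set α, A.Nonempty → BddAbove A → ∃ a, IsLUB A a) {C : Set α}
    (Q : α → α → Prop) (hQ : ∀ w ∈ C, ∀ x ∈ C, ∀ y ∈ C, ∀ z ∈ C, w ≤ x → x < y → y ≤ z →
      Q x y → Q w z)
    (hchain : ∀ x ∈ C, ∀ y ∈ C, ∀ z ∈ C, x < y → y < z → Q x y → ¬ Q y z) :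
    ∃ d, ∀ x ∈ C, ∀ y ∈ C, x < y → d ∉ Set.Icc x y → ¬ Q x y := by
  by_cases hD : ∃ x ∈ C, ∃ z ∈ C, x < z ∧ Q x z
  swap
  · exact ⟨Classical.arbitrary α, fun x hx y hy hxy _ h => hD ⟨x, hx, y, hy, hxy, h⟩⟩
  obtain ⟨x₀, hx₀, z₀, hz₀, h₀, hq₀⟩ := hD
  -- The isolating point is the supremum of the left endpoints of related pairs; a left endpoint
  -- beyond `z₀` would produce a chain of length two.
  obtain ⟨d, hd⟩ := hα {x ∈ C | ∃ z ∈ C, x < z ∧ Q x z} ⟨x₀, hx₀, z₀, hz₀, h₀, hq₀⟩ ⟨z₀, by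
    rintro x ⟨hx, z, hz, hxz, hq⟩
    by_contra! h
    exact hchain x₀ hx₀ z₀ hz₀ z hz h₀ (h.trans hxz) hq₀
      (hQ z₀ hz₀ x hx z hz z hz h.le hxz le_rfl hq)⟩
  refine ⟨d, fun x hx y hy hxy hdxy hq => ?_⟩
  have hxd : x ≤ d := hd.1 ⟨hx, y, hy, hxy, hq⟩
  have hyd : y < d := by
    by_contra! h
    exact hdxy ⟨hxd, h⟩
  obtain ⟨w, ⟨hw, z, hz, hwz, hwq⟩, hyw, -⟩ := hd.exists_between hyd
  exact hchain x hx y hy z hz hxy (hyw.trans hwz) hq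
    (hQ y hy w hw z hz z hz hyw.le hwz le_rfl hwq)

end Order

/-! ### Splits for well orders and for complete orders -/

section Splits

variable {M : Type w} [Monoid M] [Finite M]

/-- A nonempty union of classes contains a minimal class. -/
theorem exists_minimal_class {T : Set M} (hne : T.Nonempty)
    (hsat : ∀ a ∈ T, ∀ b, JEquiv b a → b ∈ T) :
    ∃ a₀ ∈ T, (∀ b ∈ T, JLE b a₀ → JEquiv b a₀) ∧
      (∀ a ∈ T \ {a | JEquiv a a₀}, ∀ b, JEquiv b a → b ∈ T \ {a | JEquiv a a₀}) ∧
      (T \ {a | JEquiv a a₀}).ncard + Nat.card {a // JEquiv a a₀} = T.ncard := by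
  obtain ⟨a₀, ha₀, hmin⟩ := T.toFinite.exists_minimalFor (fun a : M => {b | JLE b a}) T hne
  refine ⟨a₀, ha₀, fun b hb hba => ⟨hba, hmin hb (fun c hc => JLE.trans hc hba) (JLE.refl a₀)⟩, ?_, ?_⟩
  · rintro a ⟨ha, ha'⟩ b hba
    exact ⟨hsat a ha b hba, fun h => ha' (hba.symm.trans h)⟩
  · exact Set.ncard_sdiff_add_ncard_of_subset fun a ha => hsat a₀ ha₀ a ha

variable {α : Type u} [LinearOrder α] {ℓ : α → α → M}

/-- The base point `b` is what saves the extra height: it is selected but needs no colour. Two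
selected points `x < y` of `C` make the class regular through `ℓ b x * ℓ x y`, and an empty `T`
forces `C` to be empty. -/
theorem exists_isRamseyanOn_of_wellFoundedLT [WellFoundedLT α] (hℓ : IsAdditive ℓ) {T : Set M}
    (hsat : ∀ a ∈ T, ∀ b, JEquiv b a → b ∈ T) {C : Set α} (hC : C.OrdConnected) {b : α}
    (hb : ∀ x ∈ C, b < x) (hT : ∀ x ∈ insert b C, ∀ y ∈ insert b C, x < y → ℓ x y ∈ T) :
    ∃ s, IsRamseyanOn ℓ C T.ncard s := by
  classical
  induction h : T.ncard using Nat.strong_induction_on generalizing T C b with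
  | _ n ih =>
  subst h
  rcases T.eq_empty_or_nonempty with rfl | hne
  · have : C = ∅ := by
      by_contra! ⟨x, hx⟩
      exact hT b (by simp) x (by simp [hx]) (hb x hx)
    subst this
    exact ⟨fun _ => 0, by simp [IsRamseyanOn]⟩
  obtain ⟨a₀, ha₀, hmin, hsat', hcard⟩ := exists_minimal_class hne hsat
  have hQ : ∀ w ∈ insert b C, ∀ x, ∀ y, ∀ z ∈ insert b C, w ≤ x → x < y → y ≤ z →
      JEquiv (ℓ x y) a₀ → JEquiv (ℓ w z) a₀ := by
    intro w hw x y z hz hwx hxy hyz h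
    exact hmin _ (hT w hw z hz (hwx.trans_lt (hxy.trans_le hyz))) ((hℓ.JLE hwx hxy.le hyz).trans h.1)
  obtain ⟨X, hX⟩ := exists_greedy_set (insert b C) fun x y => JEquiv (ℓ x y) a₀
  have hbX : b ∈ X := by
    refine (hX b).2 ⟨by simp, fun w hw hwb => ?_⟩
    rcases ((hX w).1 hw).1 with rfl | hwC
    · exact absurd hwb (lt_irrefl _)
    · exact absurd (hb w hwC) hwb.not_gt
  have hXX : ∀ x ∈ X, ∀ y ∈ X, x < y → JEquiv (ℓ x y) a₀ := fun x hx y hy hxy =>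
    ((hX y).1 hy).2 x hx hxy
  obtain ⟨g, ε, hg⟩ := exists_group_colouring hℓ (a₀ := a₀) (X ∩ C)
    (fun x hx y hy => hXX x hx.1 y hy.1) (fun x hx y hy hxy => ⟨ℓ b x, ℓ x y,
      hXX b hbX x hx.1 (hb x hx.2), hXX x hx.1 y hy.1 hxy, by
        rw [hℓ.mul (hb x hx.2).le hxy.le]
        exact hXX b hbX y hy.1 (hb y hy.2)⟩)
  have := Fintype.ofFinite {a // JEquiv a a₀}
  rw [Nat.card_eq_fintype_card] at hcard
  rw [← hcard, add_comm]
  let c : α → Option {a // JEquiv a a₀} := fun x => if x ∈ X then some (g x) else none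
  have hc : ∀ {x i}, c x = some i → x ∈ X ∧ g x = i := by
    intro x i h
    simp only [c] at h
    split_ifs at h with hx
    exact ⟨hx, Option.some.inj h⟩
  refine exists_isRamseyanOn_of_colouring hC c _ ?_ ?_
  · intro x hx y hy x' hx' y' hy' hxy hxy' i h1 h2 h3 h4
    obtain ⟨k1, rfl⟩ := hc h1
    obtain ⟨k2, e2⟩ := hc h2
    obtain ⟨k3, e3⟩ := hc h3
    obtain ⟨k4, e4⟩ := hc h4
    obtain ⟨p1, p2⟩ := hg x ⟨k1, hx⟩ y ⟨k2, hy⟩ hxy e2.symm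
    obtain ⟨p3, -⟩ := hg x' ⟨k3, hx'⟩ y' ⟨k4, hy'⟩ hxy' (e3.trans e4.symm)
    rw [p1, p3, e3]
    exact ⟨rfl, p2.symm⟩
  · intro x hx hcx
    set U := {z ∈ C | c z = none} with hU
    have hUX : ∀ z ∈ U, z ∉ X := by
      rintro z ⟨-, hz⟩ hzX
      simp [c, hzX] at hz
    have hlow : ∀ y ∈ U, ∃ w ∈ X, w < y ∧ ¬ JEquiv (ℓ w y) a₀ := by
      intro y hy
      by_contra! hcon
      exact hUX y hy ((hX y).2 ⟨Set.mem_insert_of_mem _ hy.1, hcon⟩)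
    have hself : x ∈ Set.ordConnectedComponent U x :=
      Set.self_mem_ordConnectedComponent.2 ⟨hx, hcx⟩
    have hDc : (Set.ordConnectedComponent U x).OrdConnected := inferInstance
    set D := Set.ordConnectedComponent U x with hD
    have hDU : D ⊆ U := Set.ordConnectedComponent_subset
    have hside : ∀ w ∈ X, ∀ y ∈ D, ∀ z ∈ D, w < y → w < z := by
      intro w hw y hy z hz hwy
      by_contra! h
      exact hUX w (hDU (hDc.out hz hy ⟨h, hwy.le⟩)) hw
    obtain ⟨b', hb'X, hb'x, hb'J⟩ := hlow x ⟨hx, hcx⟩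
    have hb'ins := ((hX b').1 hb'X).1
    have hb'D : ∀ y ∈ D, b' < y := fun y hy => hside b' hb'X x hself y hy hb'x
    -- The base `b'` found for `x` serves the whole component: a witness `w` for `y` before `b'`
    -- would put `ℓ w y` in the class, and one after `b'` would put `ℓ b' x` there.
    have hlow' : ∀ y ∈ D, ¬ JEquiv (ℓ b' y) a₀ := by
      intro y hy
      obtain ⟨w, hwX, hwy, hwJ⟩ := hlow y (hDU hy)
      have hwx := hside w hwX y hy x hself hwy
      have hwins := ((hX w).1 hwX).1
      rcases lt_trichotomy w b' with h | rfl | h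
      · exact absurd (hQ w hwins w b' y (Set.mem_insert_of_mem _ (hDU hy).1) le_rfl h
          (hb'D y hy).le (hXX w hwX b' hb'X h)) hwJ
      · exact hwJ
      · exact absurd (hQ b' hb'ins b' w x (Set.mem_insert_of_mem _ hx) le_rfl h hwx.le
          (hXX b' hb'X w hwX h)) hb'J
    have hDC : ∀ y ∈ D, y ∈ insert b C := fun y hy => Set.mem_insert_of_mem _ (hDU hy).1
    have hpos : 0 < Fintype.card {a // JEquiv a a₀} := Fintype.card_pos_iff.2 ⟨⟨a₀, .refl a₀⟩⟩
    refine ih _ (by omega) hsat' hDc hb'D ?_ rfl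
    rintro y hy z hz hyz
    have hyC : y ∈ insert b C := hy.elim (fun h => h ▸ hb'ins) (hDC y)
    have hzC : z ∈ insert b C := hz.elim (fun h => h ▸ hb'ins) (hDC z)
    refine ⟨hT y hyC z hzC hyz, fun hJ => ?_⟩
    have hzD : z ∈ D := by
      rcases hz with rfl | hz
      · rcases hy with rfl | hy
        · exact absurd hyz (lt_irrefl _)
        · exact absurd (hb'D y hy) hyz.not_gt
      · exact hz
    have hby : b' ≤ y := hy.elim (fun h => h.ge) fun h => (hb'D y h).le
    exact hlow' z hzD (hQ b' hb'ins y z z hzC hby hyz le_rfl hJ)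

/-- With no base point, `T` must be nonempty, since a single point already needs height 1. A regular
class costs three families of colours; a non-regular one costs a single isolating point. -/
theorem exists_isRamseyanOn_of_complete
    (hα : ∀ A : Set α, A.Nonempty → BddAbove A → ∃ a, IsLUB A a) (hℓ : IsAdditive ℓ) {T : Set M}
    (hne : T.Nonempty) (hsat : ∀ a ∈ T, ∀ b, JEquiv b a → b ∈ T) {C : Set α}
    (hC : C.OrdConnected) (hT : ∀ x ∈ C, ∀ y ∈ C, x < y → ℓ x y ∈ T) :
    ∃ s, IsRamseyanOn ℓ C (3 * T.ncard) s := by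
  classical
  induction h : T.ncard using Nat.strong_induction_on generalizing T C with
  | _ n ih =>
  subst h
  obtain ⟨a₀, ha₀, hmin, hsat', hcard⟩ := exists_minimal_class hne hsat
  have hQ : ∀ w ∈ C, ∀ x ∈ C, ∀ y ∈ C, ∀ z ∈ C, w ≤ x → x < y → y ≤ z →
      JEquiv (ℓ x y) a₀ → JEquiv (ℓ w z) a₀ := by
    intro w hw x _ y _ z hz hwx hxy hyz h
    exact hmin _ (hT w hw z hz (hwx.trans_lt (hxy.trans_le hyz))) ((hℓ.JLE hwx hxy.le hyz).trans h.1)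
  have := Fintype.ofFinite {a // JEquiv a a₀}
  rw [Nat.card_eq_fintype_card] at hcard
  have hpos : 0 < Fintype.card {a // JEquiv a a₀} := Fintype.card_pos_iff.2 ⟨⟨a₀, .refl a₀⟩⟩
  by_cases hreg : ∃ p q, JEquiv p a₀ ∧ JEquiv q a₀ ∧ JEquiv (p * q) a₀
  · obtain ⟨c₃, h1, h2, h3⟩ := exists_three_colouring hα (fun x y => JEquiv (ℓ x y) a₀) hQ
    have hY := fun i => exists_group_colouring hℓ (a₀ := a₀) {x ∈ C | c₃ x = some i}
      (fun x hx y hy hxy => h1 x hx.1 y hy.1 hxy i hx.2 hy.2) (fun _ _ _ _ _ => hreg)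
    choose g ε hg using hY
    let c : α → Option (Fin 3 × {a // JEquiv a a₀}) := fun x => (c₃ x).map fun i => (i, g i x)
    have hc : ∀ {x i j}, c x = some (i, j) → c₃ x = some i ∧ g i x = j := by
      intro x i j h
      simp only [c, Option.map_eq_some_iff, Prod.mk.injEq] at h
      obtain ⟨i, h, rfl, rfl⟩ := h
      exact ⟨h, rfl⟩
    have hcn : ∀ {x}, c x = none → c₃ x = none := by
      intro x h
      simpa [c] using h
    have hsum : Fintype.card (Fin 3 × {a // JEquiv a a₀}) + 3 * (T \ {a | JEquiv a a₀}).ncard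
        = 3 * T.ncard := by
      rw [Fintype.card_prod, Fintype.card_fin]
      omega
    rw [← hsum]
    refine exists_isRamseyanOn_of_colouring hC c _ ?_ ?_
    · rintro x hx y hy x' hx' y' hy' hxy hxy' ⟨i, j⟩ h1 h2 h3 h4
      obtain ⟨k1, rfl⟩ := hc h1
      obtain ⟨k2, e2⟩ := hc h2
      obtain ⟨k3, e3⟩ := hc h3
      obtain ⟨k4, e4⟩ := hc h4
      obtain ⟨p1, p2⟩ := hg i x ⟨hx, k1⟩ y ⟨hy, k2⟩ hxy e2.symm
      obtain ⟨p3, -⟩ := hg i x' ⟨hx', k3⟩ y' ⟨hy', k4⟩ hxy' (e3.trans e4.symm)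
      rw [p1, p3, e3]
      exact ⟨rfl, p2.symm⟩
    · intro x hx hcx
      have hDU : Set.ordConnectedComponent {z ∈ C | c z = none} x ⊆ {z ∈ C | c z = none} :=
        Set.ordConnectedComponent_subset
      have hDc : (Set.ordConnectedComponent {z ∈ C | c z = none} x).OrdConnected := inferInstance
      -- An uncoloured point is unrelated to some other point, and that label lies in the smaller
      -- set, which is therefore nonempty.
      refine ih _ (by omega) ?_ hsat' hDc ?_ rfl
      · obtain ⟨y, hy, ⟨hlt, hJ⟩ | ⟨hlt, hJ⟩⟩ := h3 x hx (hcn hcx)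
        · exact ⟨_, hT x hx y hy hlt, hJ⟩
        · exact ⟨_, hT y hy x hx hlt, hJ⟩
      · intro y hy z hz hyz
        exact ⟨hT y (hDU hy).1 z (hDU hz).1 hyz, h2 y (hDU hy).1 z (hDU hz).1 hyz
          fun w hw => hcn (hDU (hDc.out hy hz hw)).2⟩
  · rcases isEmpty_or_nonempty α with hemp | hnon
    · exact ⟨fun _ => 0, fun x => isEmptyElim x, fun _ x => isEmptyElim x⟩
    obtain ⟨d, hd⟩ := exists_isolating_point hα (fun x y => JEquiv (ℓ x y) a₀) hQ (by
      intro x hx y hy z hz hxy hyz h1 h2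
      refine hreg ⟨_, _, h1, h2, ?_⟩
      rw [hℓ.mul hxy.le hyz.le]
      exact hQ x hx x hx y hy z hz le_rfl hxy hyz.le h1)
    let c : α → Option PUnit.{1} := fun x => if x = d then some default else none
    have hc : ∀ {x i}, c x = some i → x = d := by
      intro x i h
      simp only [c] at h
      split_ifs at h with hx
      exact hx
    have hcd : c d ≠ none := by simp [c]
    -- If no class remains, components have no two distinct points but still need one value; the
    -- total 2 fits under 3.
    suffices ∃ s, IsRamseyanOn ℓ C
        (Fintype.card PUnit.{1} + max 1 (3 * (T \ {a | JEquiv a a₀}).ncard)) s by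
      obtain ⟨s, hs⟩ := this
      refine ⟨s, hs.mono ?_⟩
      rw [Fintype.card_punit]
      omega
    refine exists_isRamseyanOn_of_colouring hC c _ ?_ ?_
    · intro x _ y _ x' _ y' _ hxy _ i h1 h2 _ _
      exact absurd ((hc h1).trans (hc h2).symm) hxy.ne
    · intro x hx hcx
      have hDU : Set.ordConnectedComponent {z ∈ C | c z = none} x ⊆ {z ∈ C | c z = none} :=
        Set.ordConnectedComponent_subset
      have hDc : (Set.ordConnectedComponent {z ∈ C | c z = none} x).OrdConnected := inferInstance
      set D := Set.ordConnectedComponent {z ∈ C | c z = none} x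
      have hTD : ∀ y ∈ D, ∀ z ∈ D, y < z → ℓ y z ∈ T \ {a | JEquiv a a₀} := by
        intro y hy z hz hyz
        exact ⟨hT y (hDU hy).1 z (hDU hz).1 hyz, hd y (hDU hy).1 z (hDU hz).1 hyz
          fun hw => hcd (hDU (hDc.out hy hz hw)).2⟩
      rcases (T \ {a | JEquiv a a₀}).eq_empty_or_nonempty with hemp | hne'
      · refine ⟨fun _ => 1, fun y _ => by simp, fun k y hy z hz _ _ _ _ hyz => ?_⟩
        have := hTD y hy z hz hyz
        rw [hemp] at this
        exact this.elim
      · obtain ⟨s, hs⟩ := ih _ (by omega) hne' hsat' hDc hTD rfl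
        exact ⟨s, hs.mono (le_max_right _ _)⟩

end Splits

/-! ### Adjoining an identity to the semigroup and a least element to the order -/

theorem ncard_range_coe_withOne (S : Type v) : (Set.range ((↑) : S → WithOne S)).ncard = Nat.card S := by
  rw [← Set.image_univ, Set.ncard_image_of_injective _ WithOne.coe_injective, Set.ncard_univ]

section Semigroup

variable {α : Type u} [LinearOrder α] {S : Type v} [Semigroup S]

/-- An additive labelling as a labelling with values in the monoid obtained by adjoining `1`. -/
noncomputable def AdditiveLabelling.toWithOne (σ : AdditiveLabelling α S) (x y : α) : WithOne S :=
  open Classical in if h : x < y then (σ.label x y h : WithOne S) else 1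

theorem AdditiveLabelling.toWithOne_of_lt (σ : AdditiveLabelling α S) {x y : α} (h : x < y) :
    σ.toWithOne x y = (σ.label x y h : WithOne S) := dif_pos h

theorem AdditiveLabelling.isAdditive_toWithOne (σ : AdditiveLabelling α S) :
    IsAdditive σ.toWithOne where
  self x := dif_neg (lt_irrefl x)
  mul := by
    intro x y z hxy hyz
    rcases hxy.eq_or_lt with rfl | hxy
    · rw [toWithOne, dif_neg (lt_irrefl x), one_mul]
    rcases hyz.eq_or_lt with rfl | hyz
    · rw [toWithOne, toWithOne, dif_neg (lt_irrefl y), mul_one]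
    rw [σ.toWithOne_of_lt hxy, σ.toWithOne_of_lt hyz, σ.toWithOne_of_lt (hxy.trans hyz),
      ← WithOne.coe_mul, σ.label_mul_label]

/-- `S` is an ideal of `WithOne S`, so the induction can start from `S` itself and the adjoined 1
costs no height. -/
theorem mem_range_coe_of_JEquiv {a : WithOne S} (ha : a ∈ Set.range ((↑) : S → WithOne S))
    (b : WithOne S) (h : JEquiv b a) : b ∈ Set.range ((↑) : S → WithOne S) := by
  obtain ⟨a, rfl⟩ := ha
  obtain ⟨⟨u, v, rfl⟩, -⟩ := h
  induction u with
  | one =>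
    induction v with
    | one => exact ⟨a, by simp⟩
    | coe v => exact ⟨a * v, by simp⟩
  | coe u =>
    induction v with
    | one => exact ⟨u * a, by simp⟩
    | coe v => exact ⟨u * a * v, by simp⟩

theorem hasRamseyanSplit_of_isRamseyanOn {σ : AdditiveLabelling α S} {N : ℕ} {s : α → ℕ}
    (h : IsRamseyanOn σ.toWithOne Set.univ N s) : HasRamseyanSplitOfHeightAtMost σ N := by
  refine ⟨N, le_rfl, s, fun x => h.1 x trivial, fun k _ x y x' y' hxy hxy' hn => ?_⟩
  have := h.2 k x trivial y trivial x' trivial y' trivial hxy hxy' hn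
  rw [σ.toWithOne_of_lt hxy, σ.toWithOne_of_lt hxy', ← WithOne.coe_mul, WithOne.coe_inj,
    WithOne.coe_inj] at this
  exact this

/-- Extension of a labelling by a new least element. -/
def extendBot {M : Type w} [Monoid M] (ℓ : α → α → M) (p : α → M) : WithBot α → WithBot α → M
  | ⊥, ⊥ => 1
  | ⊥, (y : α) => p y
  | (_ : α), ⊥ => 1
  | (x : α), (y : α) => ℓ x y

theorem IsAdditive.extendBot {M : Type w} [Monoid M] {ℓ : α → α → M} (hℓ : IsAdditive ℓ)
    {p : α → M} (hp : ∀ x y, x ≤ y → p x * ℓ x y = p y) : IsAdditive (extendBot ℓ p) where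
  self x := by
    induction x with
    | bot => rfl
    | coe x => exact hℓ.self x
  mul := by
    intro x y z hxy hyz
    induction x with
    | bot =>
      induction y with
      | bot => exact one_mul _
      | coe y =>
        induction z with
        | bot => simp at hyz
        | coe z => exact hp y z (by simpa using hyz)
    | coe x =>
      induction y with
      | bot => simp at hxy
      | coe y =>
        induction z with
        | bot => simp at hyz
        | coe z => exact hℓ.mul (by simpa using hxy) (by simpa using hyz)

theorem IsNeighbour.coe_withBot {s : WithBot α → ℕ} {k : ℕ} {x y : α}
    (h : IsNeighbour (fun a : α => s a) k x y) : IsNeighbour s k (x : WithBot α) y := by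
  refine ⟨h.1, h.2.1, fun z hz => ?_⟩
  induction z with
  | bot => simp [Set.mem_uIcc] at hz
  | coe z => exact h.2.2 z (by simpa [Set.mem_uIcc] using hz)

end Semigroup

theorem theorem4p1 {α : Type u} [LinearOrder α] {S : Type v} [Semigroup S] [Finite S] [Nonempty S]
    (σ : AdditiveLabelling α S) :
    (IsCompleteOrdering α → HasRamseyanSplitOfHeightAtMost σ (3 * Nat.card S)) ∧
      (WellFoundedLT α → HasRamseyanSplitOfHeightAtMost σ (Nat.card S)) := by
  have hfin : Finite (WithOne S) := inferInstanceAs (Finite (Option S))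
  have hℓ := σ.isAdditive_toWithOne
  have hmem : ∀ x y, x < y → σ.toWithOne x y ∈ Set.range ((↑) : S → WithOne S) := fun x y h =>
    ⟨_, (σ.toWithOne_of_lt h).symm⟩
  refine ⟨fun hα => ?_, fun hα => ?_⟩
  · obtain ⟨s, hs⟩ := exists_isRamseyanOn_of_complete hα.1 hℓ
      (Set.range_nonempty ((↑) : S → WithOne S)) (fun a ha => mem_range_coe_of_JEquiv ha)
      Set.ordConnected_univ (fun x _ y _ => hmem x y)
    rw [ncard_range_coe_withOne] at hs
    exact hasRamseyanSplit_of_isRamseyanOn hs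
  · obtain ⟨e⟩ := ‹Nonempty S›
    rcases isEmpty_or_nonempty α with hemp | hnon
    · exact ⟨0, Nat.zero_le _, fun _ => 0, fun x => isEmptyElim x, fun _ _ x => isEmptyElim x⟩
    obtain ⟨m, hm⟩ : ∃ m : α, ∀ x, m ≤ x := by
      obtain ⟨m, -, hm⟩ := hα.wf.has_min (Set.univ : Set α) Set.univ_nonempty
      exact ⟨m, fun x => not_lt.1 (hm x trivial)⟩
    -- Labels from the new least element must lie in `S`, but the label from `m` to itself is 1; an
    -- arbitrary factor `e` from `S` corrects this and preserves additivity.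
    let p : α → WithOne S := fun x => e * σ.toWithOne m x
    have hp : ∀ x, p x ∈ Set.range ((↑) : S → WithOne S) := by
      intro x
      rcases (hm x).eq_or_lt with rfl | h
      · exact ⟨e, by simp only [p, hℓ.self, mul_one]⟩
      · exact ⟨e * σ.label m x h, by simp only [p, σ.toWithOne_of_lt h, WithOne.coe_mul]⟩
    have hℓ' : IsAdditive (extendBot σ.toWithOne p) := hℓ.extendBot fun x y hxy => by
      simp only [p, mul_assoc, hℓ.mul (hm x) hxy]
    obtain ⟨s, hs⟩ := exists_isRamseyanOn_of_wellFoundedLT hℓ'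
      (fun a ha => mem_range_coe_of_JEquiv ha) (C := Set.Ioi ⊥) Set.ordConnected_Ioi
      (b := ⊥) (fun x hx => hx) (by
        intro x _ y _ hxy
        induction y with
        | bot => simp at hxy
        | coe y =>
          induction x with
          | bot => exact hp y
          | coe x => exact hmem x y (by simpa using hxy))
    rw [ncard_range_coe_withOne] at hs
    have hC : ∀ x : α, (x : WithBot α) ∈ Set.Ioi (⊥ : WithBot α) := WithBot.bot_lt_coe
    refine hasRamseyanSplit_of_isRamseyanOn (s := fun x => s x) ⟨fun x _ => hs.1 x (hC x), ?_⟩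
    intro k x _ y _ x' _ y' _ hxy hxy' hn
    refine hs.2 k x (hC x) y (hC y) x' (hC x') y' (hC y') (WithBot.coe_lt_coe.2 hxy)
      (WithBot.coe_lt_coe.2 hxy') ?_
    have himg : ({(x : WithBot α), (y : WithBot α), (x' : WithBot α), (y' : WithBot α)} :
        Set (WithBot α)) = (↑) '' ({x, y, x', y'} : Set α) := by
      simp only [Set.image_insert_eq, Set.image_singleton]
    rw [himg]
    rintro _ ⟨a, ha, rfl⟩ _ ⟨b, hb, rfl⟩
    exact (hn a ha b hb).coe_withBot
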